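/- Let $\mathcal A$ be a finite alphabet and equip $\mathcal A^{\mathbb Z}$ with the product of the discrete topologies and with the shift $\sigma((x_n)_n)=(x_{n+1})_n$. A substitution is a map $\tau:\mathcal A\to\mathcal A^*$, extended to words by concatenation, such that $|\tau^n(a)|\to\infty$ for every letter $a$. It induces the subshift $X_\tau$ of all $x\in\mathcal A^{\mathbb Z}$ each of whose finite words is a subword of $\tau^n(a)$ for some $n\ge 1$ and $a\in\mathcal A$; the subshifts $(X_\tau,\sigma)$ are called substitutive. A subshift is minimal if it is nonempty and each of its $\sigma$-orbits $\{\sigma^n x;\ n\in\mathbb Z\}$ is dense in it, and $\mathrm{Aut}(X,\sigma)$ denotes the group of homeomorphisms of $X$ commuting with $\sigma$. **Theorem.** For every finite group $G$ there is a minimal substitutive subshift $(X,\sigma)$ such that $\mathrm{Aut}(X,\sigma)$ is isomorphic to $\mathbb Z\oplus G$. Moreover, suppose that $G$ is nontrivial and let $G=\{g_0,g_1,\dots,g_{q-1}\}$ be any enumeration of its $q$ elements (without repetition) with $g_0$ the identity. Then the map on the alphabet $G$ given by $$\tau(g)=(g g_0)(g g_1)\cdots(g g_{q-1})\qquad(g\in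 G)$$ is a substitution of constant length $q$ that is bijective (for $a\ne b$ the words $\tau(a)$ and $\tau(b)$ differ at every coordinate), $(X_\tau,\sigma)$ is minimal, each left translation $L_g((x_n)_{n\in\mathbb Z})=(g x_n)_{n\in\mathbb Z}$ with $g\in G$ preserves $X_\tau$, and the map $(n,g)\mapsto \sigma^n\circ L_g$ is a group isomorphism from $\mathbb Z\oplus G$ onto $\mathrm{Aut}(X_\tau,\sigma)$. In particular, every automorphism of $(X_\tau,\sigma)$ is a power of the shift composed with a left translation $L_g$. -/

import Mathlib

universe u

open Filter
open SymbolicDynamics.FullShift (shift Subshift)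

namespace SubstDyn

/-- A topological dynamical system `(X, T)`, with `T` a homeomorphism of the (nonempty) space `X`,
is minimal if the orbit `{Tⁿ x ; n ∈ ℤ}` of every point is dense. -/
def IsMinimalSystem {X : Type*} [TopologicalSpace X] (T : X ≃ₜ X) : Prop :=
  Nonempty X ∧ ∀ x : X, Dense (Set.range fun n : ℤ => (T ^ n) x)

/-- `Aut(X, T)`: the group (under composition) of homeomorphisms `φ` of `X` with `φ ∘ T = T ∘ φ`. -/
def Aut {X : Type*} [TopologicalSpace X] (T : X ≃ₜ X) : Subgroup (X ≃ₜ X) :=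
  Subgroup.centralizer {T}

theorem mem_Aut {X : Type*} [TopologicalSpace X] (T φ : X ≃ₜ X) :
    φ ∈ Aut T ↔ ⇑φ ∘ ⇑T = ⇑T ∘ ⇑φ := by
  rw [Aut, Subgroup.mem_centralizer_singleton_iff]
  constructor
  · intro h
    funext x
    exact DFunLike.congr_fun h x
  · intro h
    ext x
    exact congrFun h x

section Shift

variable {A : Type*} [TopologicalSpace A]

/-- The shift map `σ` of a two-sided subshift `X`, `(σ x)ₙ = xₙ₊₁`, as a homeomorphism of `X`. -/
def shiftHomeo (X : Subshift A ℤ) : X.carrier ≃ₜ X.carrier where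
  toFun x := ⟨shift 1 x.1, X.mapsTo 1 x.2⟩
  invFun x := ⟨shift (-1) x.1, X.mapsTo (-1) x.2⟩
  left_inv x := by
    apply Subtype.ext
    funext n
    simp [shift]
  right_inv x := by
    apply Subtype.ext
    funext n
    simp [shift]
  continuous_toFun := by
    apply Continuous.subtype_mk
    exact (SymbolicDynamics.FullShift.continuous_shift 1).comp continuous_subtype_val
  continuous_invFun := by
    apply Continuous.subtype_mk
    exact (SymbolicDynamics.FullShift.continuous_shift (-1)).comp continuous_subtype_val

end Shift

section Substitution

variable {A : Type*}

/-- The word `τⁿ(a)`, where a map `τ` from letters to words acts on words by concatenation. -/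
def iterWord (τ : A → List A) (n : ℕ) (a : A) : List A :=
  (fun w : List A => w.flatMap τ)^[n] [a]

/-- A substitution: the length of `τⁿ(a)` tends to infinity for every letter `a`. -/
def IsSubstitution (τ : A → List A) : Prop :=
  ∀ a : A, Tendsto (fun n : ℕ => (iterWord τ n a).length) atTop atTop

/-- `τ` has constant length `ℓ > 0`. -/
def HasConstantLength (τ : A → List A) (ℓ : ℕ) : Prop :=
  0 < ℓ ∧ ∀ a : A, (τ a).length = ℓ

/-- A constant-length `τ` is bijective if distinct letters have images that differ at every
coordinate. -/
def IsBijectiveSubst (τ : A → List A) (ℓ : ℕ) : Prop :=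
  HasConstantLength τ ℓ ∧ ∀ a b : A, a ≠ b → ∀ i : ℕ, i < ℓ → (τ a)[i]? ≠ (τ b)[i]?

/-- The finite word `x_m … x_{m+ℓ-1}` of a two-sided sequence. -/
def wordAt (x : ℤ → A) (m : ℤ) (ℓ : ℕ) : List A :=
  List.ofFn fun i : Fin ℓ => x (m + (i : ℕ))

/-- The set `X_τ` of two-sided sequences each of whose finite words is a subword (factor) of
`τⁿ(a)` for some `n ≥ 1` and some letter `a`. -/
def substSet (τ : A → List A) : Set (ℤ → A) :=
  {x | ∀ (m : ℤ) (ℓ : ℕ), ∃ n : ℕ, 1 ≤ n ∧ ∃ a : A, wordAt x m ℓ <:+: iterWord τ n a}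

theorem shift_mem_substSet (τ : A → List A) (k : ℤ) :
    Set.MapsTo (shift k) (substSet τ) (substSet τ) := by
  intro x hx m ℓ
  have h : wordAt (shift k x) m ℓ = wordAt x (k + m) ℓ := by
    simp [wordAt, shift, add_assoc]
  rw [h]
  exact hx (k + m) ℓ

variable [TopologicalSpace A] [DiscreteTopology A]

theorem isClosed_substSet (τ : A → List A) : IsClosed (substSet τ) := by
  have h : substSet τ = ⋂ (m : ℤ) (ℓ : ℕ),
      (fun (x : ℤ → A) (i : Fin ℓ) => x (m + (i : ℕ))) ⁻¹'
        {w : Fin ℓ → A | ∃ n : ℕ, 1 ≤ n ∧ ∃ a : A, List.ofFn w <:+: iterWord τ n a} := by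
    ext x
    simp [substSet, wordAt]
  rw [h]
  refine isClosed_iInter fun m => isClosed_iInter fun ℓ => ?_
  exact (isClosed_discrete _).preimage (by fun_prop)

/-- The subshift `(X_τ, σ)` induced by `τ`. -/
def substSubshift (τ : A → List A) : Subshift A ℤ where
  carrier := substSet τ
  isClosed := isClosed_substSet τ
  mapsTo := shift_mem_substSet τ

/-- A subshift is substitutive if it is induced by some substitution on its alphabet. -/
def IsSubstitutive (X : Subshift A ℤ) : Prop :=
  ∃ τ : A → List A, IsSubstitution τ ∧ X = substSubshift τ

end Substitution

section Group

variable {G : Type*} [Group G]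

/-- The left translation `L_g` on two-sided sequences over `G`: `L_g((xₙ)ₙ) = (g xₙ)ₙ`. -/
def leftTranslate (g : G) (x : ℤ → G) : ℤ → G := fun n => g * x n

/-- The substitution `g ↦ (g g₀)(g g₁)⋯(g g_{q-1})` on the alphabet `G`, for an enumeration
`g₀, …, g_{q-1}` of `G`. -/
def groupSubst {q : ℕ} (e : Fin q ≃ G) : G → List G :=
  fun g => List.ofFn fun i : Fin q => g * e i

end Group

end SubstDyn

/-! Everything is proved for a finite group `K` acting transitively on an alphabet `A` with at least
two letters, and the substitution `a ↦ (e₀ • a)⋯(e_{q-1} • a)` with `q = |K|` and `e₀ = 1`. The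
claim is that automorphisms are exactly shifts composed with letter permutations commuting with `K`.

Every point `x` of `X_τ` is a concatenation of words `τ(yₙ)` with `y` again in `X_τ`
(`exists_isDesubst`). If `x'` is the image of `x` under a block code, the desubstituted points are
related by a block code whose window parameter is divided by `q` (`IsDesubst.isBlockImage`), so
descent reaches a one-letter code. Such a code matches cutting points with cutting points: otherwise
`yₙ` would determine `yₙ₊₁`, which `not_exists_succ_eq` excludes. Once cuts match, the letter map
commutes with `K`, and it lifts back through the desubstitutions. Since orbits are dense, one point
determines the automorphism.

For nontrivial `G`, let `K = Gᵐᵒᵖ` act on `G` by right multiplication; the commuting permutations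
are the left translations. For trivial `G`, take all permutations of three letters, whose
centralizer is trivial. -/

namespace SubstDyn

/-! ### Iterates of the substitution, desubstitution, and occurrence of words. -/

section ActionSubst

variable {K A : Type*} [Group K] [MulAction K A] {q : ℕ}

/-- The substitution `a ↦ (e₀ • a)(e₁ • a)⋯(e_{q-1} • a)` attached to an action of a group `K` on
the alphabet and an enumeration `e` of `K`. -/
def actionSubst (A : Type*) [MulAction K A] (e : Fin q ≃ K) : A → List A :=
  fun a => List.ofFn fun i : Fin q => e i • a

variable [NeZero q]

/-- The enumeration `e` read at a natural number modulo `q`. -/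
def column {K : Type*} (e : Fin q ≃ K) (i : ℕ) : K := e (Fin.ofNat q i)

/-- The product of the `e`-values of the base-`q` digits of `n`, least significant digit first.
The `n`-th letter of a sufficiently long word `τᵏ(a)` is `digitProd e n • a`. -/
def digitProd (e : Fin q ≃ K) (n : ℕ) : K := ((Nat.digits q n).map (column e)).prod

theorem column_zero {e : Fin q ≃ K} (he : e 0 = 1) : column e 0 = 1 := by
  have : Fin.ofNat q 0 = 0 := by ext; simp
  rw [column, this, he]

theorem exists_column_eq {K : Type*} (e : Fin q ≃ K) (k : K) : ∃ i < q, column e i = k :=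
  ⟨e.symm k, (e.symm k).2, by simp [column]⟩

theorem column_val {K : Type*} (e : Fin q ≃ K) (i : Fin q) : column e i = e i := by
  simp [column]

theorem digitProd_zero (e : Fin q ≃ K) : digitProd e 0 = 1 := by
  simp [digitProd]

/-- Appending a low digit `i` to `n` is the passage from the `n`-th letter to the `i`-th letter of
its image. The empty digit list of `0` is harmless because `e 0 = 1`. -/
theorem digitProd_mul_add {e : Fin q ≃ K} (he : e 0 = 1) (hq : 1 < q) (n : ℕ) {i : ℕ}
    (hi : i < q) : digitProd e (q * n + i) = column e i * digitProd e n := by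
  by_cases h : i ≠ 0 ∨ n ≠ 0
  · rw [digitProd, add_comm, Nat.digits_add q hq i n hi h]
    simp [digitProd]
  · push Not at h
    obtain ⟨rfl, rfl⟩ := h
    simp [digitProd_zero, column_zero he]

theorem flatMap_range_ofFn {B : Type*} (f : ℕ → B) (q m : ℕ) :
    ((List.range m).flatMap fun n => List.ofFn fun i : Fin q => f (q * n + i)) =
      (List.range (q * m)).map f := by
  induction m with
  | zero => simp
  | succ m ih =>
    rw [List.range_succ, List.flatMap_append, ih, mul_add, mul_one, List.range_add]
    simp [List.ofFn_eq_map, ← List.map_coe_finRange_eq_range]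

theorem iterWord_succ {B : Type*} (τ : B → List B) (n : ℕ) (a : B) :
    iterWord τ (n + 1) a = (iterWord τ n a).flatMap τ := by
  simp [iterWord, Function.iterate_succ_apply']

theorem iterWord_actionSubst {e : Fin q ≃ K} (he : e 0 = 1) (hq : 1 < q) (n : ℕ) (a : A) :
    iterWord (actionSubst A e) n a = (List.range (q ^ n)).map fun i => digitProd e i • a := by
  induction n with
  | zero => simp [iterWord, digitProd_zero]
  | succ n ih =>
    rw [iterWord_succ, ih, pow_succ', ← flatMap_range_ofFn, List.flatMap_map]
    congr 1
    funext m
    simp [actionSubst, digitProd_mul_add he hq, mul_smul, column_val]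

theorem isSubstitution_actionSubst {e : Fin q ≃ K} (he : e 0 = 1) (hq : 1 < q) :
    IsSubstitution (actionSubst A e) := by
  intro a
  simp only [iterWord_actionSubst he hq, List.length_map, List.length_range]
  exact tendsto_pow_atTop_atTop_of_one_lt hq

theorem wordAt_infix_map_range {B : Type*} (x : ℤ → B) (f : ℕ → B) (m : ℤ) (l M : ℕ) :
    wordAt x m l <:+: (List.range M).map f ↔
      ∃ k, k + l ≤ M ∧ ∀ i < l, x (m + i) = f (k + i) := by
  rw [List.infix_iff_getElem?]
  constructor
  · rintro ⟨k, hk, h⟩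
    simp only [wordAt, List.length_ofFn, List.length_map, List.length_range] at hk h
    refine ⟨k, by omega, fun i hi => ?_⟩
    have := h i hi
    rw [List.getElem?_map, List.getElem?_range (by omega)] at this
    simpa [add_comm, eq_comm] using this
  · rintro ⟨k, hk, h⟩
    refine ⟨k, by simp [wordAt]; omega, fun i hi => ?_⟩
    simp only [wordAt, List.length_ofFn] at hi
    rw [List.getElem?_map, List.getElem?_range (by omega)]
    simp [wordAt, h i hi, add_comm]

/-- All iterates of `a` are prefixes of the single sequence `digitProd e n • a`, so centred windows
of that sequence suffice. The bound `N ≤ p` keeps `toNat` from truncating. -/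
theorem mem_substSet_iff {e : Fin q ≃ K} (he : e 0 = 1) (hq : 1 < q) {x : ℤ → A} :
    x ∈ substSet (actionSubst A e) ↔ ∀ N : ℕ, ∃ (a : A) (p : ℤ), N ≤ p ∧
      ∀ j : ℤ, |j| ≤ N → x j = digitProd e (p + j).toNat • a := by
  simp only [substSet, Set.mem_ofPred_eq, iterWord_actionSubst he hq, wordAt_infix_map_range]
  constructor
  · intro h N
    obtain ⟨n, -, a, k, -, h⟩ := h (-N) (2 * N + 1)
    refine ⟨a, k + N, by omega, fun j hj => ?_⟩
    rw [abs_le] at hj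
    have := h (j + N).toNat (by omega)
    rw [show (-(N : ℤ) + ((j + N).toNat : ℕ)) = j by omega] at this
    rw [this]
    congr 2
    omega
  · intro h m l
    obtain ⟨a, p, hp, h⟩ := h (m.natAbs + l)
    have hlt : p.toNat + (m.natAbs + l) < q ^ (p.toNat + (m.natAbs + l) + 1) :=
      (Nat.lt_succ_self _).trans (Nat.lt_pow_self hq)
    refine ⟨p.toNat + (m.natAbs + l) + 1, by omega, a, (p + m).toNat, by omega, fun i hi => ?_⟩
    rw [h (m + i) (by rw [abs_le]; omega)]
    congr 2
    omega

theorem comp_mem_substSet {e : Fin q ≃ K} (he : e 0 = 1) (hq : 1 < q) {F : A → A}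
    (hF : ∀ (k : K) (b : A), F (k • b) = k • F b) {x : ℤ → A}
    (hx : x ∈ substSet (actionSubst A e)) : F ∘ x ∈ substSet (actionSubst A e) := by
  rw [mem_substSet_iff he hq] at hx ⊢
  intro N
  obtain ⟨a, p, hp, h⟩ := hx N
  exact ⟨F a, p, hp, fun j hj => by rw [Function.comp_apply, h j hj, hF]⟩

/-- `x` is the concatenation of the words `τ(yₙ)`, the word `τ(y₀)` starting at coordinate `r`. -/
def IsDesubst (e : Fin q ≃ K) (x : ℤ → A) (r : ℤ) (y : ℤ → A) : Prop :=
  ∀ (n : ℤ) (i : ℕ), i < q → x (q * n + r + i) = column e i • y n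

theorem exists_isDesubst {e : Fin q ≃ K} (he : e 0 = 1) (hq : 1 < q) {x : ℤ → A}
    (hx : x ∈ substSet (actionSubst A e)) :
    ∃ (r : ℤ) (y : ℤ → A), y ∈ substSet (actionSubst A e) ∧ IsDesubst e x r y := by
  rw [mem_substSet_iff he hq] at hx
  have hq0 : (0 : ℤ) < q := by omega
  obtain ⟨r, hr⟩ : ∃ r : Fin q, ∀ N : ℕ, ∃ (a : A) (p : ℤ), N ≤ p ∧ (q : ℤ) ∣ p + (r : ℕ) ∧
      ∀ j : ℤ, |j| ≤ N → x j = digitProd e (p + j).toNat • a := by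
    -- Pigeonhole on the residue of the window position: if each `r` failed at some radius `N r`,
    -- the largest of these radii would give a contradiction.
    by_contra! hcon
    choose N hN using hcon
    obtain ⟨a, p, hp, h⟩ := hx (Finset.univ.sup N)
    have hmod := Int.emod_nonneg (-p) hq0.ne'
    have hmod' := Int.emod_lt_of_pos (-p) hq0
    let r : Fin q := ⟨((-p) % q).toNat, by omega⟩
    have hle : N r ≤ Finset.univ.sup N := Finset.le_sup (Finset.mem_univ r)
    obtain ⟨j, hj, hne⟩ := hN r a p (by omega) (by
      have : ((r : ℕ) : ℤ) = (-p) % q := by simp only [r]; omega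
      rw [this]
      refine Int.dvd_of_emod_eq_zero ?_
      simp)
    exact hne (h j (by omega))
  have key : ∀ M : ℕ, ∃ (a : A) (c : ℤ), M ≤ c ∧ ∀ n : ℤ, |n| ≤ M → ∀ i : ℕ, i < q →
      x (q * n + (r : ℕ) + i) = column e i • digitProd e (c + n).toNat • a := by
    intro M
    -- This radius covers every block with index `|n| ≤ M`, since `r + i < 2 * q`.
    obtain ⟨a, p, hp, ⟨c, hc⟩, h⟩ := hr (q * M + 2 * q)
    have hrq : ((r : ℕ) : ℤ) < q := by have := r.2; omega
    push_cast at hp h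
    have hMc : (M : ℤ) ≤ c := by
      by_contra! hlt
      nlinarith
    refine ⟨a, c, hMc, fun n hn i hi => ?_⟩
    have hqn : |(q : ℤ) * n| ≤ q * M := by
      rw [abs_mul, abs_of_pos hq0]
      exact mul_le_mul_of_nonneg_left hn hq0.le
    rw [abs_le] at hqn hn
    rw [h _ (by rw [abs_le]; omega), ← mul_smul, ← digitProd_mul_add he hq _ hi]
    congr 2
    have : ((q * (c + n).toNat : ℕ) : ℤ) = q * c + q * n := by
      rw [Nat.cast_mul, Int.toNat_of_nonneg (by omega), mul_add]
    omega
  have hsub : IsDesubst e x (r : ℕ) (fun n => x (q * n + (r : ℕ))) := by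
    intro n i hi
    obtain ⟨a, c, -, h⟩ := key n.natAbs
    have h0 := h n (Int.abs_eq_natAbs n).le 0 (by omega)
    rw [column_zero he, one_smul, Nat.cast_zero, add_zero] at h0
    rw [h n (Int.abs_eq_natAbs n).le i hi]
    exact congrArg _ h0.symm
  refine ⟨(r : ℕ), _, ?_, hsub⟩
  rw [mem_substSet_iff he hq]
  intro M
  obtain ⟨a, c, hc, h⟩ := key M
  refine ⟨a, c, hc, fun n hn => ?_⟩
  have h0 := h n hn 0 (by omega)
  rwa [column_zero he, one_smul, Nat.cast_zero, add_zero] at h0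

theorem surjective_of_mem_substSet [MulAction.IsPretransitive K A] {e : Fin q ≃ K} (he : e 0 = 1)
    (hq : 1 < q) {x : ℤ → A} (hx : x ∈ substSet (actionSubst A e)) : Function.Surjective x := by
  intro a
  obtain ⟨r, y, -, hy⟩ := exists_isDesubst he hq hx
  obtain ⟨k, hk⟩ := MulAction.exists_smul_eq K (y 0) a
  obtain ⟨i, hi, rfl⟩ := exists_column_eq e k
  exact ⟨_, (hy 0 i hi).trans hk⟩

/-- An occurrence of `τⁿ(a)` in the desubstituted point becomes, under `τ`, one of `τⁿ⁺¹(a)` in `x`.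
This gives minimality. -/
theorem exists_occurrence [MulAction.IsPretransitive K A] {e : Fin q ≃ K} (he : e 0 = 1)
    (hq : 1 < q) (n : ℕ) (a : A) {x : ℤ → A} (hx : x ∈ substSet (actionSubst A e)) :
    ∃ m : ℤ, ∀ t < q ^ n, x (m + t) = digitProd e t • a := by
  induction n generalizing x with
  | zero =>
    obtain ⟨m, hm⟩ := surjective_of_mem_substSet he hq hx a
    refine ⟨m, fun t ht => ?_⟩
    obtain rfl : t = 0 := by simpa using ht
    simp [hm, digitProd_zero]
  | succ n ih =>
    obtain ⟨r, y, hyX, hy⟩ := exists_isDesubst he hq hx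
    obtain ⟨m, hm⟩ := ih hyX
    refine ⟨q * m + r, fun t ht => ?_⟩
    have hmod : t % q < q := Nat.mod_lt _ (by omega)
    have hdiv : t / q < q ^ n := Nat.div_lt_of_lt_mul (by rwa [← pow_succ'])
    have h := hy (m + (t / q : ℕ)) (t % q) hmod
    rw [hm _ hdiv, ← mul_smul, ← digitProd_mul_add he hq _ hmod, Nat.div_add_mod] at h
    rw [← h]
    congr 1
    have : ((q * (t / q) + t % q : ℕ) : ℤ) = t := by rw [Nat.div_add_mod]
    push_cast at this ⊢
    linarith

theorem exists_shift_agree [MulAction.IsPretransitive K A] {e : Fin q ≃ K} (he : e 0 = 1)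
    (hq : 1 < q) {x y : ℤ → A} (hx : x ∈ substSet (actionSubst A e))
    (hy : y ∈ substSet (actionSubst A e)) (N : ℕ) :
    ∃ m : ℤ, ∀ j : ℤ, |j| ≤ N → x (m + j) = y j := by
  obtain ⟨a, p, hp, h⟩ := (mem_substSet_iff he hq).1 hy N
  obtain ⟨m, hm⟩ := exists_occurrence he hq (p.toNat + N) a hx
  refine ⟨m + p, fun j hj => ?_⟩
  have hlt : p.toNat + N < q ^ (p.toNat + N) := Nat.lt_pow_self hq
  rw [h j hj, ← hm _ (by rw [abs_le] at hj; omega)]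
  congr 1
  rw [abs_le] at hj
  omega

/-- A successor rule `f` would have to be the action of the fixed element `column e 1`, whose `q`-th
power is trivial. Then `y` has period `q`, so its desubstitution is constant, yet it takes every
letter. -/
theorem not_exists_succ_eq [MulAction.IsPretransitive K A] [Nontrivial A] {e : Fin q ≃ K}
    (he : e 0 = 1) (hq : 1 < q) {y : ℤ → A} (hy : y ∈ substSet (actionSubst A e)) :
    ¬ ∃ f : A → A, ∀ n, y (n + 1) = f (y n) := by
  rintro ⟨f, hf⟩
  obtain ⟨r, z, hzX, hz⟩ := exists_isDesubst he hq hy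
  have hsurj := surjective_of_mem_substSet he hq hzX
  have hstart : ∀ n : ℤ, y (q * n + r) = z n := fun n => by
    simpa [column_zero he] using hz n 0 (by omega)
  have hf1 : ∀ a, f a = column e 1 • a := by
    intro a
    obtain ⟨n, rfl⟩ := hsurj a
    rw [← hz n 1 hq, ← hstart n, ← hf]
    simp
  have hpow : ∀ (m : ℕ) (n : ℤ), y (n + m) = column e 1 ^ m • y n := by
    intro m n
    induction m with
    | zero => simp
    | succ m ih =>
      rw [Nat.cast_succ, ← add_assoc, hf, hf1, ih, pow_succ', mul_smul]
  have hcard : column e 1 ^ q = 1 := by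
    have : Nat.card K = q := by rw [← Nat.card_congr e, Nat.card_fin]
    exact orderOf_dvd_iff_pow_eq_one.1 ((orderOf_dvd_natCard _).trans this.dvd)
  have hconst : ∀ n, z (n + 1) = z n := by
    intro n
    rw [← hstart, ← hstart, show (q : ℤ) * (n + 1) + r = q * n + r + (q : ℕ) by ring, hpow,
      hcard, one_smul]
  have hall : ∀ n, z n = z 0 := by
    intro n
    induction n using Int.induction_on with
    | zero => rfl
    | succ n ih => rw [hconst, ih]
    | pred n ih => rw [← ih, ← hconst, sub_add_cancel]
  obtain ⟨a, b, hab⟩ := exists_pair_ne A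
  obtain ⟨n, rfl⟩ := hsurj a
  obtain ⟨m, rfl⟩ := hsurj b
  exact hab ((hall n).trans (hall m).symm)

end ActionSubst

end SubstDyn

namespace SubstDyn

/-! ### Descent on block codes between points, and aperiodicity. -/

section BlockImage

variable {K A : Type*} [Group K] [MulAction K A] {q : ℕ} [NeZero q]

/-- The `n`-th letter of the second sequence depends only on the word `x_{n+a} … x_{n+a+w}` of the
first. -/
def IsBlockImage {A : Type*} (x x' : ℤ → A) (a : ℤ) (w : ℕ) : Prop :=
  ∀ n n' : ℤ, (∀ j ≤ w, x (n + a + (j : ℕ)) = x (n' + a + (j : ℕ))) → x' n = x' n'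

theorem IsDesubst.start {e : Fin q ≃ K} (he : e 0 = 1) {x y : ℤ → A} {r : ℤ}
    (h : IsDesubst e x r y) (n : ℤ) : x (q * n + r) = y n := by
  simpa [column_zero he] using h n 0 (NeZero.pos q)

theorem exists_eq_mul_add {q : ℕ} (hq : 1 < q) (m : ℤ) :
    ∃ (c : ℤ) (k : ℕ), k < q ∧ m = q * c + k := by
  have hq0 : (0 : ℤ) < q := by omega
  have h1 := Int.emod_nonneg m hq0.ne'
  have h2 := Int.emod_lt_of_pos m hq0
  refine ⟨m / q, (m % q).toNat, by omega, ?_⟩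
  rw [Int.toNat_of_nonneg h1]
  exact (Int.mul_ediv_add_emod m q).symm

theorem IsDesubst.isBlockImage {e : Fin q ≃ K} (hq : 1 < q) {x x' y y' : ℤ → A} {r r' a : ℤ}
    {w : ℕ} (hy : IsDesubst e x r y) (hy' : IsDesubst e x' r' y') (h : IsBlockImage x x' a w) :
    ∃ c, IsBlockImage y y' c (w / q) := by
  -- Any letter of the block `τ(y'ₙ)` determines `y' n`; position `t` is chosen so that its window
  -- in `x` starts at a cutting point.
  obtain ⟨c, t, ht, hc⟩ := exists_eq_mul_add hq (r - r' - a)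
  refine ⟨-c, fun n n' hn => ?_⟩
  have := h (q * n + r' + t) (q * n' + r' + t) fun j hj => ?_
  · rw [hy' n t ht, hy' n' t ht] at this
    exact smul_left_cancel _ this
  · have hmod : j % q < q := Nat.mod_lt _ (by omega)
    have hj' : (j : ℤ) = q * (j / q : ℕ) + (j % q : ℕ) := by
      exact_mod_cast (Nat.div_add_mod j q).symm
    have key : ∀ n : ℤ, x (q * n + r' + t + a + j) =
        column e (j % q) • y (n + -c + (j / q : ℕ)) := by
      intro n
      rw [← hy _ _ hmod]
      congr 1
      linarith
    rw [key, key, hn _ (Nat.div_le_div_right hj)]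

theorem exists_equivariant_of_letter_image [Finite A] [Nontrivial A]
    [MulAction.IsPretransitive K A] {e : Fin q ≃ K} (he : e 0 = 1) (hq : 1 < q) {x x' : ℤ → A}
    (hx : x ∈ substSet (actionSubst A e)) (hx' : x' ∈ substSet (actionSubst A e)) {a : ℤ}
    (h : IsBlockImage x x' a 0) :
    ∃ F : Equiv.Perm A, (∀ (k : K) (b : A), F (k • b) = k • F b) ∧ ∀ m, x' m = F (x (m + a)) := by
  obtain ⟨F, hF⟩ : ∃ F : A → A, ∀ m, x' m = F (x (m + a)) := by
    choose p hp using surjective_of_mem_substSet he hq hx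
    refine ⟨fun b => x' (p b - a), fun m => h _ _ fun j hj => ?_⟩
    obtain rfl : j = 0 := by omega
    simp [hp]
  have hbij : Function.Bijective F := by
    refine Finite.surjective_iff_bijective.1 fun b => ?_
    obtain ⟨m, rfl⟩ := surjective_of_mem_substSet he hq hx' b
    exact ⟨_, (hF m).symm⟩
  let E := Equiv.ofBijective F hbij
  obtain ⟨r, y, hyX, hy⟩ := exists_isDesubst he hq hx
  obtain ⟨r', y', -, hy'⟩ := exists_isDesubst he hq hx'
  obtain ⟨c, k, hk, hc⟩ := exists_eq_mul_add hq (r' + a - r)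
  have hFy : ∀ (n : ℤ) (i : ℕ), i < q → E (x (q * n + r + k + i)) = column e i • y' (n - c) := by
    intro n i hi
    rw [← hy' _ _ hi, hF]
    simp only [E, Equiv.ofBijective_apply]
    congr 2
    linarith
  obtain rfl | hk0 := Nat.eq_zero_or_pos k
  · refine ⟨E, fun g b => ?_, hF⟩
    obtain ⟨i, hi, rfl⟩ := exists_column_eq e g
    obtain ⟨n, rfl⟩ := surjective_of_mem_substSet he hq hyX b
    have h0 := hFy n 0 (by omega)
    have hi' := hFy n i hi
    rw [Nat.cast_zero, add_zero] at h0 hi'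
    rw [hy n i hi] at hi'
    rw [add_zero, hy.start he, column_zero he, one_smul] at h0
    rw [hi', h0]
  -- Misaligned cuts: one block of `x'` meets block `n` of `x` at offset `k` and also the first
  -- letter of block `n + 1`, so `y n` determines `y (n + 1)`.
  · refine absurd ⟨fun b => E.symm (column e (q - k) • E (column e k • b)), fun n => ?_⟩
      (not_exists_succ_eq he hq hyX)
    have h0 := hFy n 0 (by omega)
    have h1 := hFy n (q - k) (by omega)
    rw [Nat.cast_zero, add_zero, hy n k hk, column_zero he, one_smul] at h0
    rw [show (q : ℤ) * n + r + k + ((q - k : ℕ) : ℤ) = q * (n + 1) + r by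
      rw [Nat.cast_sub hk.le]; ring, hy.start he] at h1
    beta_reduce
    rw [h0, ← h1, Equiv.symm_apply_apply]

/-- A point of `X_τ` that is the image of another one under a block code is obtained from it by a
shift and a letter-to-letter map commuting with the action. -/
theorem exists_equivariant_of_isBlockImage [Finite A] [Nontrivial A]
    [MulAction.IsPretransitive K A] {e : Fin q ≃ K} (he : e 0 = 1) (hq : 1 < q) {x x' : ℤ → A}
    (hx : x ∈ substSet (actionSubst A e)) (hx' : x' ∈ substSet (actionSubst A e)) {a : ℤ} {w : ℕ}
    (h : IsBlockImage x x' a w) :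
    ∃ F : Equiv.Perm A, (∀ (k : K) (b : A), F (k • b) = k • F b) ∧
      ∃ s : ℤ, ∀ m, x' m = F (x (m + s)) := by
  induction w using Nat.strong_induction_on generalizing x x' a with
  | _ w ih =>
    obtain rfl | hw := Nat.eq_zero_or_pos w
    · obtain ⟨F, hF, hFx⟩ := exists_equivariant_of_letter_image he hq hx hx' h
      exact ⟨F, hF, a, hFx⟩
    obtain ⟨r, y, hyX, hy⟩ := exists_isDesubst he hq hx
    obtain ⟨r', y', hyX', hy'⟩ := exists_isDesubst he hq hx'
    obtain ⟨c, hc⟩ := hy.isBlockImage hq hy' h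
    obtain ⟨F, hF, s, hs⟩ := ih _ (Nat.div_lt_self hw hq) hyX hyX' hc
    refine ⟨F, hF, q * s + r - r', fun m => ?_⟩
    obtain ⟨n, i, hi, hm⟩ := exists_eq_mul_add hq (m - r')
    obtain rfl : m = q * n + r' + i := by linarith
    rw [hy' n i hi, hs, ← hF, ← hy _ i hi]
    congr 2
    ring

/-- If `q ∣ s`, the relation descends to `y` with the smaller shift `s / q`; otherwise the cuts are
misaligned and `not_exists_succ_eq` applies. This yields injectivity of the map to `Aut`. -/
theorem eq_zero_of_shift_eq [Nontrivial A]
    [MulAction.IsPretransitive K A] {e : Fin q ≃ K} (he : e 0 = 1) (hq : 1 < q) {x : ℤ → A}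
    (hx : x ∈ substSet (actionSubst A e)) {F : Equiv.Perm A} {s : ℤ}
    (h : ∀ m, F (x (s + m)) = x m) : s = 0 := by
  induction hN : s.natAbs using Nat.strong_induction_on generalizing x s with
  | _ N ih =>
    by_contra hs
    obtain ⟨r, y, hyX, hy⟩ := exists_isDesubst he hq hx
    obtain ⟨c, k, hk, rfl⟩ := exists_eq_mul_add hq s
    obtain rfl | hk0 := Nat.eq_zero_or_pos k
    · rw [Nat.cast_zero, add_zero] at hs hN h
      have hc0 : c ≠ 0 := by rintro rfl; simp at hs
      refine hc0 (ih c.natAbs ?_ hyX (s := c) (fun m => ?_) rfl)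
      · rw [← hN, Int.natAbs_mul, Int.natAbs_natCast]
        have := Int.natAbs_pos.2 hc0
        nlinarith
      · have := h (q * m + r)
        rw [hy.start he, show (q : ℤ) * c + (q * m + r) = q * (c + m) + r by ring,
          hy.start he] at this
        exact this
    · refine not_exists_succ_eq he hq hyX
        ⟨fun b => F.symm (column e (q - k) • F (column e k • b)), fun n => ?_⟩
      have h0 := h (q * (n - c) + r)
      have h1 := h (q * (n - c) + r + (q - k : ℕ))
      rw [hy.start he, show (q : ℤ) * c + k + (q * (n - c) + r) = q * n + r + k by ring,
        hy n k hk] at h0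
      rw [hy _ _ (by omega), show (q : ℤ) * c + k + (q * (n - c) + r + (q - k : ℕ)) =
        q * (n + 1) + r by rw [Nat.cast_sub hk.le]; ring, hy.start he] at h1
      beta_reduce
      rw [h0, ← h1, Equiv.symm_apply_apply]

end BlockImage

end SubstDyn

namespace SubstDyn

/-! ### Topology of subshifts: automorphisms are block codes. -/

section Shift

variable {A : Type*} [TopologicalSpace A]

theorem coe_shiftHomeo_zpow (X : Subshift A ℤ) (n : ℤ) (x : X.carrier) :
    ((shiftHomeo X ^ n) x : ℤ → A) = shift n x := by
  induction n using Int.induction_on generalizing x with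
  | zero => simp
  | succ n ih =>
    rw [zpow_add_one, Homeomorph.mul_apply, ih]
    exact funext fun m => congrArg x.1 (show 1 + (n + m) = n + 1 + m by ring)
  | pred n ih =>
    rw [zpow_sub_one, Homeomorph.mul_apply, ih]
    exact funext fun m => congrArg x.1 (show -1 + (-n + m) = -n - 1 + m by ring)

theorem apply_zpow_of_mem_Aut {X : Type*} [TopologicalSpace X] {T φ : X ≃ₜ X} (hφ : φ ∈ Aut T)
    (n : ℤ) (x : X) : φ ((T ^ n) x) = (T ^ n) (φ x) := by
  have h : Commute φ T := Subgroup.mem_centralizer_singleton_iff.1 hφ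
  exact DFunLike.congr_fun (h.zpow_right n).eq x

theorem exists_forall_agree_mem {x : ℤ → A} {V : Set (ℤ → A)} (hV : V ∈ nhds x) :
    ∃ N : ℕ, ∀ z : ℤ → A, (∀ j : ℤ, |j| ≤ N → z j = x j) → z ∈ V := by
  obtain ⟨W, hWV, hW, hxW⟩ := mem_nhds_iff.1 hV
  obtain ⟨I, u, hu, hI⟩ := isOpen_pi_iff.1 hW x hxW
  refine ⟨I.sup Int.natAbs, fun z hz => hWV (hI fun j hj => ?_)⟩
  have hle : j.natAbs ≤ I.sup Int.natAbs := Finset.le_sup hj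
  rw [hz j (by rw [Int.abs_eq_natAbs]; exact_mod_cast hle)]
  exact (hu j hj).2

theorem setOf_agree_mem_nhds [DiscreteTopology A] (x : ℤ → A) (N : ℕ) :
    {z : ℤ → A | ∀ j : ℤ, |j| ≤ N → z j = x j} ∈ nhds x := by
  refine mem_of_superset ((SymbolicDynamics.FullShift.isOpen_cylinder
    (Finset.Icc (-(N : ℤ)) N) x).mem_nhds ?_) fun z hz j hj => ?_
  · rw [SymbolicDynamics.FullShift.mem_cylinder]
    exact fun _ _ => rfl
  · rw [SymbolicDynamics.FullShift.mem_cylinder] at hz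
    exact hz j (by rw [Finset.mem_Icc]; exact abs_le.1 hj)

/-- A continuous map on a subshift over a finite alphabet has a coordinate `0` depending only on
finitely many coordinates. -/
theorem exists_radius [Finite A] [DiscreteTopology A] (X : Subshift A ℤ)
    {φ : X.carrier → X.carrier} (hφ : Continuous φ) :
    ∃ R : ℕ, ∀ x y : X.carrier, (∀ j : ℤ, |j| ≤ R → x.1 j = y.1 j) → (φ x).1 0 = (φ y).1 0 := by
  have : CompactSpace X.carrier := isCompact_iff_compactSpace.1 X.isClosed.isCompact
  have key : ∃ R : ℕ, ∀ x ∈ (Set.univ : Set X.carrier), ∀ y : X.carrier,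
      (∀ j : ℤ, |j| ≤ R → x.1 j = y.1 j) → (φ x).1 0 = (φ y).1 0 := by
    -- A uniform radius passes to subsets and finite unions and exists locally, hence globally by
    -- compactness.
    refine isCompact_univ.induction_on
      (p := fun S => ∃ R : ℕ, ∀ x ∈ S, ∀ y : X.carrier,
        (∀ j : ℤ, |j| ≤ R → x.1 j = y.1 j) → (φ x).1 0 = (φ y).1 0) ⟨0, by simp⟩ ?_ ?_ ?_
    · rintro S S' hS ⟨R, hR⟩
      exact ⟨R, fun x hx => hR x (hS hx)⟩
    · rintro S S' ⟨R, hR⟩ ⟨R', hR'⟩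
      refine ⟨max R R', fun x hx y hxy => ?_⟩
      rcases hx with hx | hx
      · exact hR x hx y fun j hj => hxy j (hj.trans (by simp))
      · exact hR' x hx y fun j hj => hxy j (hj.trans (by simp))
    · intro x _
      have hcont : Continuous fun z : X.carrier => (φ z).1 0 :=
        (continuous_apply 0).comp (continuous_subtype_val.comp hφ)
      have hnhds : {z : X.carrier | (φ z).1 0 = (φ x).1 0} ∈ nhds x :=
        hcont.continuousAt.preimage_mem_nhds ((isOpen_discrete {(φ x).1 0}).mem_nhds rfl)
      obtain ⟨V, hV, hVsub⟩ := mem_nhds_subtype _ _ _ |>.1 hnhds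
      obtain ⟨N, hN⟩ := exists_forall_agree_mem hV
      refine ⟨{z | ∀ j : ℤ, |j| ≤ N → z.1 j = x.1 j}, mem_nhdsWithin_of_mem_nhds
        (continuous_subtype_val.continuousAt.preimage_mem_nhds (setOf_agree_mem_nhds x.1 N)),
        N, fun z hz y hzy => ?_⟩
      have h1 : (φ z).1 0 = (φ x).1 0 := hVsub (hN z.1 hz)
      have h2 : (φ y).1 0 = (φ x).1 0 :=
        hVsub (hN y.1 fun j hj => (hzy j hj).symm.trans (hz j hj))
      rw [h1, h2]
  obtain ⟨R, hR⟩ := key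
  exact ⟨R, fun x => hR x trivial⟩

theorem exists_isBlockImage_of_mem_Aut [Finite A] [DiscreteTopology A] (X : Subshift A ℤ)
    {φ : X.carrier ≃ₜ X.carrier} (hφ : φ ∈ Aut (shiftHomeo X)) (x : X.carrier) :
    ∃ (a : ℤ) (w : ℕ), IsBlockImage x.1 (φ x).1 a w := by
  obtain ⟨R, hR⟩ := exists_radius X φ.continuous
  have hval : ∀ n : ℤ, (φ x).1 n = (φ ((shiftHomeo X ^ n) x)).1 0 := by
    intro n
    rw [apply_zpow_of_mem_Aut hφ, coe_shiftHomeo_zpow]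
    simp [shift]
  refine ⟨-R, 2 * R, fun n n' h => ?_⟩
  rw [hval, hval]
  refine hR _ _ fun j hj => ?_
  rw [coe_shiftHomeo_zpow, coe_shiftHomeo_zpow]
  rw [abs_le] at hj
  have := h (j + R).toNat (by omega)
  rw [Int.toNat_of_nonneg (by omega)] at this
  simpa [shift, add_assoc] using this

end Shift

/-! ### Minimality and the automorphism group. -/

section Automorphisms

variable {K A : Type*} [Group K] [MulAction K A] {q : ℕ} [NeZero q]
  [TopologicalSpace A] [DiscreteTopology A]

theorem nonempty_substSet [Finite A] [Nonempty A] {e : Fin q ≃ K} (he : e 0 = 1) (hq : 1 < q) :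
    (substSet (actionSubst A e)).Nonempty := by
  obtain ⟨a⟩ := ‹Nonempty A›
  -- A limit of the sequence `digitProd e n • a` recentred ever further to the right.
  obtain ⟨x, hx⟩ := exists_clusterPt_of_compactSpace
    (map (fun (k : ℕ) (j : ℤ) => digitProd e (k + j).toNat • a) atTop)
  refine ⟨x, (mem_substSet_iff he hq).2 fun N => ?_⟩
  have hfreq := (mapClusterPt_iff_frequently.1 hx) _ (setOf_agree_mem_nhds x N)
  obtain ⟨k, hk, hkN⟩ := (hfreq.and_eventually (eventually_ge_atTop N)).exists
  exact ⟨a, k, by exact_mod_cast hkN, fun j hj => (hk j hj).symm⟩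

theorem isMinimalSystem_actionSubst [Finite A] [Nonempty A] [MulAction.IsPretransitive K A]
    {e : Fin q ≃ K} (he : e 0 = 1) (hq : 1 < q) :
    IsMinimalSystem (shiftHomeo (substSubshift (actionSubst A e))) := by
  refine ⟨(nonempty_substSet he hq).to_subtype, fun x y => mem_closure_iff_nhds.2 fun V hV => ?_⟩
  obtain ⟨W, hW, hWV⟩ := mem_nhds_subtype _ _ _ |>.1 hV
  obtain ⟨N, hN⟩ := exists_forall_agree_mem hW
  obtain ⟨m, hm⟩ := exists_shift_agree he hq x.2 y.2 N
  refine ⟨_, hWV (hN _ fun j hj => ?_), m, rfl⟩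
  rw [coe_shiftHomeo_zpow]
  exact hm j hj

/-- The homeomorphism of `X_τ` that applies an equivariant permutation to every letter. -/
def letterHomeo {e : Fin q ≃ K} (he : e 0 = 1) (hq : 1 < q) (F : Equiv.Perm A)
    (hF : ∀ (k : K) (b : A), F (k • b) = k • F b) :
    (substSubshift (actionSubst A e)).carrier ≃ₜ (substSubshift (actionSubst A e)).carrier where
  toFun x := ⟨F ∘ x.1, comp_mem_substSet he hq hF x.2⟩
  invFun x := ⟨F.symm ∘ x.1, comp_mem_substSet he hq
    (fun k b => F.injective (by rw [hF, F.apply_symm_apply, F.apply_symm_apply])) x.2⟩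
  left_inv x := by
    apply Subtype.ext
    funext n
    simp
  right_inv x := by
    apply Subtype.ext
    funext n
    simp
  continuous_toFun := by
    refine Continuous.subtype_mk (continuous_pi fun n => ?_) _
    exact continuous_of_discreteTopology.comp ((continuous_apply n).comp continuous_subtype_val)
  continuous_invFun := by
    refine Continuous.subtype_mk (continuous_pi fun n => ?_) _
    exact continuous_of_discreteTopology.comp ((continuous_apply n).comp continuous_subtype_val)

theorem coe_zpow_mul_letterHomeo {e : Fin q ≃ K} (he : e 0 = 1) (hq : 1 < q) (F : Equiv.Perm A)
    (hF : ∀ (k : K) (b : A), F (k • b) = k • F b) (n m : ℤ)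
    (x : (substSubshift (actionSubst A e)).carrier) :
    ((shiftHomeo (substSubshift (actionSubst A e)) ^ n * letterHomeo he hq F hF) x).1 m =
      F (x.1 (n + m)) := by
  rw [Homeomorph.mul_apply, coe_shiftHomeo_zpow]
  rfl

theorem zpow_mul_letterHomeo_mem_Aut {e : Fin q ≃ K} (he : e 0 = 1) (hq : 1 < q)
    (F : Equiv.Perm A) (hF : ∀ (k : K) (b : A), F (k • b) = k • F b) (n : ℤ) :
    shiftHomeo (substSubshift (actionSubst A e)) ^ n * letterHomeo he hq F hF ∈
      Aut (shiftHomeo (substSubshift (actionSubst A e))) := by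
  rw [mem_Aut]
  funext x
  apply Subtype.ext
  funext m
  rw [Function.comp_apply, Function.comp_apply, coe_zpow_mul_letterHomeo]
  change F (x.1 (1 + (n + m))) = Subtype.val ((_ * letterHomeo he hq F hF) x) (1 + m)
  rw [coe_zpow_mul_letterHomeo, add_left_comm]

/-- If a group `C` acts on the alphabet as the group of all permutations commuting with the action
of `K`, then `Aut(X_τ, σ)` is `ℤ × C`, via shifts and letter-to-letter maps. -/
theorem exists_mulEquiv_Aut [Finite A] [Nontrivial A] [MulAction.IsPretransitive K A]
    {e : Fin q ≃ K} (he : e 0 = 1) (hq : 1 < q) {C : Type*} [Group C] (ρ : C →* Equiv.Perm A)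
    (hinj : Function.Injective ρ) (hcomm : ∀ (c : C) (k : K) (b : A), ρ c (k • b) = k • ρ c b)
    (hsurj : ∀ F : Equiv.Perm A, (∀ (k : K) (b : A), F (k • b) = k • F b) → ∃ c, ρ c = F) :
    ∃ Φ : Multiplicative ℤ × C ≃* Aut (shiftHomeo (substSubshift (actionSubst A e))),
      ∀ (n : ℤ) (c : C) (x : (substSubshift (actionSubst A e)).carrier) (m : ℤ),
        ((Φ (Multiplicative.ofAdd n, c)).1 x).1 m = ρ c (x.1 (n + m)) := by
  let f : Multiplicative ℤ × C →* Aut (shiftHomeo (substSubshift (actionSubst A e))) :=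
    MonoidHom.mk' (fun p => ⟨_, zpow_mul_letterHomeo_mem_Aut he hq (ρ p.2) (hcomm p.2)
      (Multiplicative.toAdd p.1)⟩) (by
        rintro ⟨n, c⟩ ⟨n', c'⟩
        refine Subtype.ext (Homeomorph.ext fun x => Subtype.ext (funext fun m => ?_))
        refine (coe_zpow_mul_letterHomeo he hq (ρ (c * c')) (hcomm _) _ m x).trans
          (.trans ?_ (coe_zpow_mul_letterHomeo he hq (ρ c) (hcomm c) _ m _).symm)
        rw [map_mul, Equiv.Perm.mul_apply, Prod.mk_mul_mk, toAdd_mul, add_right_comm, add_comm]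
        exact congrArg (ρ c) (coe_zpow_mul_letterHomeo he hq (ρ c') (hcomm c') _ _ x).symm)
  have hf : ∀ (n : ℤ) (c : C) (x : (substSubshift (actionSubst A e)).carrier) (m : ℤ),
      ((f (Multiplicative.ofAdd n, c)).1 x).1 m = ρ c (x.1 (n + m)) :=
    fun n c x m => coe_zpow_mul_letterHomeo he hq (ρ c) (hcomm c) n m x
  obtain ⟨⟨x₀⟩, hmin⟩ := isMinimalSystem_actionSubst (A := A) he hq
  have hbij : Function.Bijective f := by
    constructor
    · rw [injective_iff_map_eq_one]
      rintro ⟨n, c⟩ h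
      have hx : ∀ m, ρ c (x₀.1 (Multiplicative.toAdd n + m)) = x₀.1 m := by
        intro m
        rw [← hf, ofAdd_toAdd, h]
        rfl
      have hn : Multiplicative.toAdd n = 0 := eq_zero_of_shift_eq he hq x₀.2 hx
      have hc : c = 1 := by
        refine hinj (Equiv.ext fun b => ?_)
        obtain ⟨m, rfl⟩ := surjective_of_mem_substSet he hq x₀.2 b
        have := hx m
        rw [hn, zero_add] at this
        rw [this, map_one, Equiv.Perm.one_apply]
      rw [hc, toAdd_eq_zero.1 hn]
      rfl
    · rintro ⟨φ, hφ⟩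
      obtain ⟨a, w, hw⟩ := exists_isBlockImage_of_mem_Aut _ hφ x₀
      obtain ⟨F, hF, s, hs⟩ := exists_equivariant_of_isBlockImage he hq x₀.2 (φ x₀).2 hw
      obtain ⟨c, rfl⟩ := hsurj F hF
      refine ⟨(Multiplicative.ofAdd s, c), Subtype.ext (DFunLike.coe_injective ?_)⟩
      -- Both maps commute with the shift, so agreement at `x₀` spreads to its dense orbit.
      refine Continuous.ext_on (hmin x₀) (Homeomorph.continuous _) (Homeomorph.continuous _) ?_
      rintro _ ⟨n, rfl⟩
      beta_reduce
      rw [apply_zpow_of_mem_Aut (f _).2, apply_zpow_of_mem_Aut hφ]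
      congr 1
      refine Subtype.ext (funext fun m => ?_)
      rw [hf, hs, add_comm]
  exact ⟨MulEquiv.ofBijective f hbij, hf⟩

end Automorphisms

/-! ### Enumerations of finite groups and the centralizer of the full symmetric group. -/

section Enumeration

theorem exists_equiv_apply_zero_eq_one (K : Type*) [Group K] [Finite K] :
    ∃ (q : ℕ) (_ : NeZero q) (e : Fin q ≃ K), e 0 = 1 := by
  classical
  have : NeZero (Nat.card K) := ⟨Nat.card_pos.ne'⟩
  exact ⟨Nat.card K, this, (Finite.equivFin K).symm.trans
    (Equiv.swap ((Finite.equivFin K).symm 0) 1), by simp⟩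

theorem one_lt_of_equiv {K : Type*} [Nontrivial K] {q : ℕ} (e : Fin q ≃ K) : 1 < q :=
  Fin.nontrivial_iff_two_le.1 e.nontrivial

theorem perm_eq_one_of_commute {A : Type*} (hA : ∀ a b : A, ∃ c, c ≠ a ∧ c ≠ b)
    {F : Equiv.Perm A} (hF : ∀ (k : Equiv.Perm A) (b : A), F (k • b) = k • F b) : F = 1 := by
  classical
  refine Equiv.ext fun b => ?_
  by_contra hne
  rw [Equiv.Perm.one_apply] at hne
  obtain ⟨c, hcb, hcF⟩ := hA b (F b)
  -- This transposition fixes `b` but moves `F b`.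
  have h := hF (Equiv.swap (F b) c) b
  rw [Equiv.Perm.smul_def, Equiv.Perm.smul_def, Equiv.swap_apply_left,
    Equiv.swap_apply_of_ne_of_ne (Ne.symm hne) hcb.symm] at h
  exact hcF h.symm

end Enumeration

/-! ### The regular action of `G`, and the theorem. -/

section Group

variable {G : Type*} [Group G] {q : ℕ}

theorem groupSubst_eq_actionSubst (e : Fin q ≃ G) :
    groupSubst e = actionSubst G (e.trans MulOpposite.opEquiv) := rfl

theorem isBijectiveSubst_groupSubst [NeZero q] (e : Fin q ≃ G) :
    IsBijectiveSubst (groupSubst e) q := by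
  refine ⟨⟨NeZero.pos q, fun a => by simp [groupSubst]⟩, fun a b hab i hi => ?_⟩
  simpa [groupSubst, hi] using hab

theorem isSubstitution_groupSubst [Nontrivial G] [NeZero q] {e : Fin q ≃ G} (he : e 0 = 1) :
    IsSubstitution (groupSubst e) := by
  rw [groupSubst_eq_actionSubst]
  exact isSubstitution_actionSubst (by simp [he]) (one_lt_of_equiv e)

theorem isMinimalSystem_groupSubst [Finite G] [Nontrivial G] [TopologicalSpace G]
    [DiscreteTopology G] [NeZero q] {e : Fin q ≃ G} (he : e 0 = 1) :
    IsMinimalSystem (shiftHomeo (substSubshift (groupSubst e))) := by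
  rw [groupSubst_eq_actionSubst]
  exact isMinimalSystem_actionSubst (by simp [he]) (one_lt_of_equiv e)

theorem exists_mulEquiv_Aut_groupSubst [Finite G] [Nontrivial G] [TopologicalSpace G]
    [DiscreteTopology G] [NeZero q] {e : Fin q ≃ G} (he : e 0 = 1) :
    ∃ Φ : Multiplicative ℤ × G ≃* Aut (shiftHomeo (substSubshift (groupSubst e))),
      ∀ (n : ℤ) (g : G) (x : (substSubshift (groupSubst e)).carrier),
        ((Φ (Multiplicative.ofAdd n, g)).1 x : ℤ → G) = shift n (leftTranslate g x) := by
  obtain ⟨Φ, hΦ⟩ := exists_mulEquiv_Aut (A := G) (e := e.trans MulOpposite.opEquiv)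
    (by simp [he]) (one_lt_of_equiv e) (MulAction.toPermHom G G) MulAction.toPerm_injective
    (fun c k b => by simp [mul_assoc])
    -- Commuting with right multiplications forces `F b = F 1 * b`.
    (fun F hF => ⟨F 1, Equiv.ext fun b => by simpa using (hF (MulOpposite.op b) 1).symm⟩)
  exact ⟨Φ, fun n g x => funext fun m => hΦ n g x m⟩

end Group

end SubstDyn

/-- First part: every finite group `G` is realized as `Aut(X, σ) ≅ ℤ ⊕ G` by a minimal substitutive
subshift over a finite (discrete) alphabet. Second part: if `G` is nontrivial, then for every
enumeration `g₀ = 1, g₁, …, g_{q-1}` of `G` the subshift of `g ↦ (g g₀)⋯(g g_{q-1})` is such an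
example, and `(n, g) ↦ σⁿ ∘ L_g` is an isomorphism `ℤ ⊕ G ≅ Aut(X_τ, σ)`. -/
theorem theorem3p6 (G : Type u) [Group G] [Finite G] :
    (∃ (A : Type u) (_ : Finite A) (_ : TopologicalSpace A) (_ : DiscreteTopology A)
        (X : Subshift A ℤ),
      SubstDyn.IsSubstitutive X ∧
      SubstDyn.IsMinimalSystem (SubstDyn.shiftHomeo X) ∧
      Nonempty (SubstDyn.Aut (SubstDyn.shiftHomeo X) ≃* Multiplicative ℤ × G)) ∧
    (∀ [Nontrivial G] [TopologicalSpace G] [DiscreteTopology G] (q : ℕ) [NeZero q]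
        (e : Fin q ≃ G), e 0 = 1 →
      SubstDyn.IsSubstitution (SubstDyn.groupSubst e) ∧
      SubstDyn.IsBijectiveSubst (SubstDyn.groupSubst e) q ∧
      SubstDyn.IsMinimalSystem
        (SubstDyn.shiftHomeo (SubstDyn.substSubshift (SubstDyn.groupSubst e))) ∧
      (∃ Φ : Multiplicative ℤ × G ≃*
          SubstDyn.Aut (SubstDyn.shiftHomeo (SubstDyn.substSubshift (SubstDyn.groupSubst e))),
        ∀ (n : ℤ) (g : G) (x : (SubstDyn.substSubshift (SubstDyn.groupSubst e)).carrier),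
          ((Φ (Multiplicative.ofAdd n, g)).1 x : ℤ → G) =
            shift n (SubstDyn.leftTranslate g x)) ∧
      (∀ φ ∈ SubstDyn.Aut (SubstDyn.shiftHomeo (SubstDyn.substSubshift (SubstDyn.groupSubst e))),
        ∃ (n : ℤ) (g : G),
          ∀ x : (SubstDyn.substSubshift (SubstDyn.groupSubst e)).carrier,
            (φ x : ℤ → G) = shift n (SubstDyn.leftTranslate g x))) := by
  constructor
  · rcases subsingleton_or_nontrivial G with hG | hG
    -- The one-letter alphabet `G` gives no growth, and on two letters the swap commutes with every
    -- permutation; three letters are the least that work here.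
    · let _ : TopologicalSpace (ULift.{u} (Fin 3)) := ⊥
      have : DiscreteTopology (ULift.{u} (Fin 3)) := ⟨rfl⟩
      have hthird : ∀ a b : ULift.{u} (Fin 3), ∃ c, c ≠ a ∧ c ≠ b := by
        rintro ⟨a⟩ ⟨b⟩
        obtain ⟨c, hca, hcb⟩ : ∃ c : Fin 3, c ≠ a ∧ c ≠ b := by decide +revert
        exact ⟨⟨c⟩, by simpa [ULift.ext_iff] using hca, by simpa [ULift.ext_iff] using hcb⟩
      obtain ⟨q, _, e, he⟩ :=
        SubstDyn.exists_equiv_apply_zero_eq_one (Equiv.Perm (ULift.{u} (Fin 3)))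
      have hq := SubstDyn.one_lt_of_equiv e
      obtain ⟨Φ, -⟩ := SubstDyn.exists_mulEquiv_Aut (A := ULift.{u} (Fin 3)) he hq
        (1 : G →* Equiv.Perm (ULift.{u} (Fin 3))) (Function.injective_of_subsingleton _)
        (fun _ _ _ => rfl) (fun F hF => ⟨1, (SubstDyn.perm_eq_one_of_commute hthird hF).symm⟩)
      exact ⟨ULift.{u} (Fin 3), inferInstance, inferInstance, inferInstance, _,
        ⟨_, SubstDyn.isSubstitution_actionSubst he hq, rfl⟩,
        SubstDyn.isMinimalSystem_actionSubst he hq, ⟨Φ.symm⟩⟩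
    · let _ : TopologicalSpace G := ⊥
      have : DiscreteTopology G := ⟨rfl⟩
      obtain ⟨q, _, e, he⟩ := SubstDyn.exists_equiv_apply_zero_eq_one G
      obtain ⟨Φ, -⟩ := SubstDyn.exists_mulEquiv_Aut_groupSubst he
      exact ⟨G, inferInstance, inferInstance, inferInstance,
        SubstDyn.substSubshift (SubstDyn.groupSubst e),
        ⟨_, SubstDyn.isSubstitution_groupSubst he, rfl⟩,
        SubstDyn.isMinimalSystem_groupSubst he, ⟨Φ.symm⟩⟩
  · intro _ _ _ q _ e he
    obtain ⟨Φ, hΦ⟩ := SubstDyn.exists_mulEquiv_Aut_groupSubst he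
    refine ⟨SubstDyn.isSubstitution_groupSubst he, SubstDyn.isBijectiveSubst_groupSubst e,
      SubstDyn.isMinimalSystem_groupSubst he, ⟨Φ, hΦ⟩, fun φ hφ => ?_⟩
    obtain ⟨⟨n, g⟩, h⟩ := Φ.surjective ⟨φ, hφ⟩
    refine ⟨Multiplicative.toAdd n, g, fun x => ?_⟩
    rw [← hΦ, ofAdd_toAdd, h]
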